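/- Let $m\ge 3$ and let $C_m$ be the chordless $m$-cycle, i.e. the graph with vertex set $[m]=\{1,\dots,m\}$ and edges $\{1,2\},\{2,3\},\dots,\{m-1,m\},\{1,m\}$. Let $\mathbb{S}_{\succeq 0}^m(C_m)$ be the cone of real symmetric positive semidefinite $m\times m$ matrices $\Sigma=(\sigma_{ij})$ with $\sigma_{ij}=0$ whenever $i\ne j$ and $\{i,j\}$ is not an edge of $C_m$. Let $\Delta$ be the simplicial complex whose facets are the edges of $C_m$ (so its faces are $\emptyset$, the singletons $\{i\}$ and the edges), and define $$\phi_{C_m}:\prod_{F\in\Delta}\mathbb{R}^{F}\to\mathbb{S}_{\succeq 0}^m,\qquad \phi_{C_m}(\gamma)=\Gamma(\gamma)\Gamma(\gamma)^T,$$ where $\Gamma(\gamma)$ is the matrix with rows indexed by $[m]$ and columns indexed by $\Delta$ whose $(i,F)$ entry is $\gamma_{i,F}$ if $i\in F$ and $0$ otherwise. Let $\mathcal{M}(C_m)$ be the collection of all (not necessarily maximal, possibly empty) matchings of $C_m$, that is, of all sets of pairwise disjoint edges, and for $M\in\mathcal{M}(C_m)$ write $[m]\setminus M$ for the set of nodes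 not incident to any edge in $M$. **Theorem.** A matrix $\Sigma=(\sigma_{ij})\in\mathbb{S}_{\succeq 0}^m(C_m)$ is in the image of $\phi_{C_m}$ if and only if $$\sum_{M\in\mathcal{M}(C_m)}(-1)^{|M|}\prod_{\{i,j\}\in M}\sigma_{ij}^2\prod_{i\in[m]\setminus M}\sigma_{ii}\;\ge\;2\prod_{i=1}^m|\sigma_{i,i+1}|,$$ where indices are read modulo $m$, so that $\sigma_{m,m+1}=\sigma_{1m}$. -/

import Mathlib

namespace EdgeParam

/-- For an edge `e = {i, j}`, the number `σ i j * σ j i`, which is `σ_{ij}²` for a symmetric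
matrix (see `edgeSq_mk`). -/
def edgeSq {V : Type*} (σ : Matrix V V ℝ) (e : Sym2 V) : ℝ :=
  Sym2.lift ⟨fun i j => σ i j * σ j i, fun _ _ => mul_comm _ _⟩ e

theorem edgeSq_mk {V : Type*} {σ : Matrix V V ℝ} (hσ : σ.IsSymm) (i j : V) :
    edgeSq σ s(i, j) = σ i j ^ 2 := by
  simp [edgeSq, hσ.apply i j, sq]

variable {V : Type*} [Fintype V] [DecidableEq V]

/-- The cone of positive semidefinite matrices with zeros at the non-edges of `G`. -/
def graphicalCone (G : SimpleGraph V) : Set (Matrix V V ℝ) :=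
  {σ | σ.PosSemidef ∧ ∀ i j, i ≠ j → ¬ G.Adj i j → σ i j = 0}

/-- The parameter space: the product over `F ∈ Δ` of `ℝ ^ F`. -/
abbrev Param (Δ : Finset (Finset V)) : Type _ :=
  (F : {F : Finset V // F ∈ Δ}) → {i : V // i ∈ F.1} → ℝ

/-- The matrix `Γ(γ)` with rows indexed by the vertices and columns indexed by the faces; its
entry at `(i, F)` is `γ_{i,F}` if `i ∈ F` and zero otherwise. -/
def gammaMatrix (Δ : Finset (Finset V)) (γ : Param Δ) :
    Matrix V {F : Finset V // F ∈ Δ} ℝ :=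
  Matrix.of fun i F => if h : i ∈ F.1 then γ F ⟨i, h⟩ else 0

/-- The parametrization `φ_Δ(γ) = Γ(γ) Γ(γ)ᵀ`. -/
def phi (Δ : Finset (Finset V)) (γ : Param Δ) : Matrix V V ℝ :=
  gammaMatrix Δ γ * (gammaMatrix Δ γ).transpose

/-- The edge complex of `G`: its faces are the empty set, the vertices and the edges. -/
def edgeComplex (G : SimpleGraph V) [DecidableRel G.Adj] : Finset (Finset V) :=
  Finset.univ.filter fun F => F.card ≤ 1 ∨ ∃ u v, G.Adj u v ∧ F = {u, v}

/-- All matchings of `G` (not necessarily maximal): sets of pairwise disjoint edges. -/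
def matchings (G : SimpleGraph V) [DecidableRel G.Adj] : Finset (Finset (Sym2 V)) :=
  G.edgeFinset.powerset.filter fun M =>
    ∀ e ∈ M, ∀ f ∈ M, e ≠ f → ∀ v, ¬ (v ∈ e ∧ v ∈ f)

/-- The nodes not incident to any edge in `M`. -/
def uncovered (M : Finset (Sym2 V)) : Finset V :=
  Finset.univ.filter fun v => ∀ e ∈ M, v ∉ e

/-- The sum over all matchings `M` of `G` of
`(-1)^|M| ∏_{{i,j} ∈ M} σ_{ij}² ∏_{i not covered by M} σ_{ii}`. -/
def matchingSum (G : SimpleGraph V) [DecidableRel G.Adj] (σ : Matrix V V ℝ) : ℝ :=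
  ∑ M ∈ matchings G, (-1) ^ M.card * (∏ e ∈ M, edgeSq σ e) * ∏ i ∈ uncovered M, σ i i

end EdgeParam

namespace EdgeParam

/-! ### The image of the edge parametrization: sign changes, dominance, closedness. -/

section Parametrization

variable {V : Type*} [DecidableEq V]

/-! Keep the diagonal of Σ and replace every off-diagonal entry by minus its absolute value. For any
graph, a symmetric Σ supported on it lies in the image exactly when this comparison matrix is
positive semidefinite (`mem_range_phi_iff_posSemidef_comparisonMatrix`). An edge is the only face
containing both its ends, so the signs in its column are free and the image ignores off-diagonal
signs; as it consists of positive semidefinite matrices, necessity follows. Conversely, a positive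
definite matrix with nonpositive off-diagonal entries is diagonally dominant after a positive
scaling, which yields an explicit Γ; the semidefinite case follows because the image is closed.

On the cycle, the permutations moving points only along edges are the matchings and the two
rotations, so the determinant of the comparison matrix is the difference of the two sides of the
inequality (`det_comparisonMatrix_cycleGraph`). This gives necessity. For sufficiency, conjugating Σ
by diagonal signs produces either the comparison matrix itself or a matrix differing from it on one
edge only. Under the inequality the latter has positive determinant, hence is positive definite, and
`posSemidef_of_det_nonneg` finishes. -/

theorem gammaMatrix_apply_of_mem {Δ : Finset (Finset V)} (γ : Param Δ) {i : V}
    {F : {F : Finset V // F ∈ Δ}} (h : i ∈ F.1) : gammaMatrix Δ γ i F = γ F ⟨i, h⟩ := by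
  simp [gammaMatrix, h]

theorem gammaMatrix_apply_of_notMem {Δ : Finset (Finset V)} (γ : Param Δ) {i : V}
    {F : {F : Finset V // F ∈ Δ}} (h : i ∉ F.1) : gammaMatrix Δ γ i F = 0 := by
  simp [gammaMatrix, h]

theorem phi_apply (Δ : Finset (Finset V)) (γ : Param Δ) (i j : V) :
    phi Δ γ i j = ∑ F, gammaMatrix Δ γ i F * gammaMatrix Δ γ j F := by
  simp [phi, Matrix.mul_apply]

theorem phi_isSymm (Δ : Finset (Finset V)) (γ : Param Δ) : (phi Δ γ).IsSymm := by
  simp [phi, Matrix.IsSymm, Matrix.transpose_mul]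

theorem continuous_phi (Δ : Finset (Finset V)) : Continuous (phi Δ) := by
  refine continuous_matrix fun i j => ?_
  simp only [phi_apply]
  refine continuous_finsetSum _ fun F _ => ?_
  have h : ∀ k, Continuous fun γ : Param Δ => gammaMatrix Δ γ k F := fun k => by
    by_cases hk : k ∈ F.1
    · simp only [gammaMatrix_apply_of_mem _ hk]
      fun_prop
    · simp only [gammaMatrix_apply_of_notMem _ hk]
      fun_prop
  exact (h i).mul (h j)

/-- A diagonal entry is the sum of the squares of a row of Γ, so bounded diagonals confine the
parameters to a compact box. -/
theorem abs_le_of_phi_le {Δ : Finset (Finset V)} {γ : Param Δ} {C : ℝ} (hC : 0 ≤ C)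
    (h : ∀ i, phi Δ γ i i ≤ C * C) (F : {F : Finset V // F ∈ Δ}) (i : {i : V // i ∈ F.1}) :
    |γ F i| ≤ C := by
  refine abs_le_of_sq_le_sq ?_ hC
  have h1 := h i
  rw [phi_apply] at h1
  have h2 := Finset.single_le_sum (f := fun F => gammaMatrix Δ γ i F * gammaMatrix Δ γ i F)
    (fun F _ => mul_self_nonneg _) (Finset.mem_univ F)
  simp only [gammaMatrix_apply_of_mem _ i.2] at h2
  nlinarith

variable [Fintype V]

theorem posSemidef_phi (Δ : Finset (Finset V)) (γ : Param Δ) : (phi Δ γ).PosSemidef := by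
  simpa [phi] using Matrix.posSemidef_self_mul_conjTranspose (gammaMatrix Δ γ)

variable (G : SimpleGraph V) [DecidableRel G.Adj]

theorem pair_mem_edgeComplex {i j : V} (h : G.Adj i j) : {i, j} ∈ edgeComplex G := by
  simp only [edgeComplex, Finset.mem_filter, Finset.mem_univ, true_and]
  exact Or.inr ⟨i, j, h, rfl⟩

theorem eq_pair_of_mem_edgeComplex {F : Finset V} (hF : F ∈ edgeComplex G) {i j : V}
    (hij : i ≠ j) (hi : i ∈ F) (hj : j ∈ F) : G.Adj i j ∧ F = {i, j} := by
  simp only [edgeComplex, Finset.mem_filter, Finset.mem_univ, true_and] at hF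
  rcases hF with hF | ⟨u, v, huv, rfl⟩
  · exact absurd (Finset.card_le_one.1 hF i hi j hj) hij
  · simp only [Finset.mem_insert, Finset.mem_singleton] at hi hj
    rcases hi with rfl | rfl <;> rcases hj with rfl | rfl
    · exact absurd rfl hij
    · exact ⟨huv, rfl⟩
    · exact ⟨huv.symm, Finset.pair_comm _ _⟩
    · exact absurd rfl hij

theorem phi_apply_of_adj (γ : Param (edgeComplex G)) {i j : V} (h : G.Adj i j) :
    phi (edgeComplex G) γ i j =
      gammaMatrix (edgeComplex G) γ i ⟨{i, j}, pair_mem_edgeComplex G h⟩ *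
        gammaMatrix (edgeComplex G) γ j ⟨{i, j}, pair_mem_edgeComplex G h⟩ := by
  rw [phi_apply]
  refine Fintype.sum_eq_single _ fun F hF => ?_
  by_cases hi : i ∈ F.1
  · by_cases hj : j ∈ F.1
    · exact absurd (Subtype.ext (eq_pair_of_mem_edgeComplex G F.2 h.ne hi hj).2) hF
    · rw [gammaMatrix_apply_of_notMem γ hj, mul_zero]
  · rw [gammaMatrix_apply_of_notMem γ hi, zero_mul]

theorem phi_apply_of_not_adj (γ : Param (edgeComplex G)) {i j : V} (hij : i ≠ j)
    (h : ¬ G.Adj i j) : phi (edgeComplex G) γ i j = 0 := by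
  rw [phi_apply]
  refine Fintype.sum_eq_zero _ fun F => ?_
  by_cases hi : i ∈ F.1
  · by_cases hj : j ∈ F.1
    · exact absurd (eq_pair_of_mem_edgeComplex G F.2 hij hi hj).1 h
    · rw [gammaMatrix_apply_of_notMem γ hj, mul_zero]
  · rw [gammaMatrix_apply_of_notMem γ hi, zero_mul]

/-- The sign of a real number, with the convention that zero has sign one. -/
noncomputable def unitSign (x : ℝ) : ℝ := if x < 0 then -1 else 1

theorem unitSign_mul_abs (x : ℝ) : unitSign x * |x| = x := by
  unfold unitSign
  split_ifs with h
  · rw [abs_of_neg h]; ring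
  · rw [abs_of_nonneg (not_lt.1 h), one_mul]

theorem unitSign_mul_self (x : ℝ) : unitSign x * unitSign x = 1 := by
  unfold unitSign
  split_ifs <;> norm_num

theorem unitSign_mul (x : ℝ) : unitSign x * x = |x| := by
  unfold unitSign
  split_ifs with h
  · rw [abs_of_neg h]; ring
  · rw [abs_of_nonneg (not_lt.1 h), one_mul]

/-- Membership in the range of the edge parametrization depends only on the diagonal and on the
absolute values of the off-diagonal entries. -/
theorem mem_range_phi_of_abs_eq [LinearOrder V] {σ τ : Matrix V V ℝ} (hτ : τ.IsSymm)
    (hdiag : ∀ i, τ i i = σ i i) (habs : ∀ i j, i ≠ j → |τ i j| = |σ i j|)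
    (h : σ ∈ Set.range (phi (edgeComplex G))) : τ ∈ Set.range (phi (edgeComplex G)) := by
  obtain ⟨γ, rfl⟩ := h
  -- The sign wanted on an edge is carried by its larger endpoint alone; the smaller one gets an
  -- empty product.
  let w : V → Finset V → ℝ := fun i F => ∏ j ∈ F with j < i, unitSign (τ j i)
  have hw : ∀ i F, w i F * w i F = 1 := fun i F => by
    simp only [w, ← Finset.prod_mul_distrib, unitSign_mul_self, Finset.prod_const_one]
  have hwlt : ∀ i j, i < j → w i {i, j} * w j {i, j} = unitSign (τ i j) := fun i j hij => by
    have h1 : ({i, j} : Finset V).filter (· < i) = ∅ := by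
      ext k; simp only [Finset.mem_filter, Finset.mem_insert, Finset.mem_singleton,
        Finset.notMem_empty, iff_false]
      rintro ⟨rfl | rfl, hk⟩
      · exact lt_irrefl _ hk
      · exact lt_asymm hij hk
    have h2 : ({i, j} : Finset V).filter (· < j) = {i} := by
      ext k; simp only [Finset.mem_filter, Finset.mem_insert, Finset.mem_singleton]
      constructor
      · rintro ⟨rfl | rfl, hk⟩
        · rfl
        · exact absurd hk (lt_irrefl _)
      · rintro rfl
        exact ⟨Or.inl rfl, hij⟩
    simp only [w, h1, h2, Finset.prod_empty, Finset.prod_singleton, one_mul]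
  let γ' : Param (edgeComplex G) := fun F i => w i.1 F.1 * |γ F i|
  have hΓ : ∀ i F, gammaMatrix (edgeComplex G) γ' i F =
      w i F.1 * |gammaMatrix (edgeComplex G) γ i F| := fun i F => by
    by_cases h : i ∈ F.1
    · rw [gammaMatrix_apply_of_mem _ h, gammaMatrix_apply_of_mem _ h]
    · rw [gammaMatrix_apply_of_notMem _ h, gammaMatrix_apply_of_notMem _ h, abs_zero, mul_zero]
  have hlt : ∀ i j, i < j → phi (edgeComplex G) γ' i j = τ i j := fun i j hij => by
    by_cases hadj : G.Adj i j
    · have h1 := habs i j hij.ne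
      rw [phi_apply_of_adj G γ hadj, abs_mul] at h1
      rw [phi_apply_of_adj G γ' hadj, hΓ, hΓ, mul_mul_mul_comm, hwlt i j hij, ← h1,
        unitSign_mul_abs]
    · have h1 := habs i j hij.ne
      rw [phi_apply_of_not_adj G γ hij.ne hadj, abs_zero, abs_eq_zero] at h1
      rw [phi_apply_of_not_adj G γ' hij.ne hadj, h1]
  refine ⟨γ', Matrix.ext fun i j => ?_⟩
  rcases lt_trichotomy i j with hij | rfl | hij
  · exact hlt i j hij
  · rw [hdiag, phi_apply, phi_apply]
    refine Finset.sum_congr rfl fun F _ => ?_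
    rw [hΓ, mul_mul_mul_comm, hw, one_mul, abs_mul_abs_self]
  · rw [← (phi_isSymm _ γ').apply i j, ← hτ.apply i j]
    exact hlt j i hij

theorem sum_edgeComplex_filter_mem (i : V) (f : Finset V → ℝ) :
    ∑ F ∈ edgeComplex G with i ∈ F, f F = f {i} + ∑ j with G.Adj i j, f {i, j} := by
  have h1 : (edgeComplex G).filter (i ∈ ·) =
      insert {i} ((Finset.univ.filter (G.Adj i)).image fun j => {i, j}) := by
    ext F
    simp only [Finset.mem_filter, Finset.mem_insert, Finset.mem_image, Finset.mem_univ, true_and]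
    constructor
    · rintro ⟨hF, hi⟩
      by_cases h : F = {i}
      · exact Or.inl h
      · obtain ⟨j, hj, hji⟩ : ∃ j ∈ F, j ≠ i := by
          by_contra! hcon
          exact h (Finset.eq_singleton_iff_unique_mem.2 ⟨hi, hcon⟩)
        obtain ⟨hadj, rfl⟩ := eq_pair_of_mem_edgeComplex G hF hji.symm hi hj
        exact Or.inr ⟨j, hadj, rfl⟩
    · rintro (rfl | ⟨j, hj, rfl⟩)
      · refine ⟨?_, Finset.mem_singleton_self i⟩
        simp [edgeComplex]
      · exact ⟨pair_mem_edgeComplex G hj, Finset.mem_insert_self _ _⟩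
  rw [h1, Finset.sum_insert, Finset.sum_image]
  · intro j hj k hk hjk
    have hj' : G.Adj i j := by simpa using hj
    have : j ∈ ({i, k} : Finset V) := by
      change ({i, j} : Finset V) = {i, k} at hjk
      rw [← hjk]; simp
    simpa [hj'.ne'] using this
  · simp only [Finset.mem_image, Finset.mem_filter, Finset.mem_univ, true_and, not_exists, not_and]
    intro j hj hij
    have h : j ∈ ({i} : Finset V) := by
      rw [← hij]; simp
    exact hj.ne' (Finset.mem_singleton.1 h)

theorem phi_apply_self_of_fun (g : V → Finset V → ℝ) (i : V) :
    phi (edgeComplex G) (fun F k => g k.1 F.1) i i =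
      g i {i} * g i {i} + ∑ j with G.Adj i j, g i {i, j} * g i {i, j} := by
  rw [← sum_edgeComplex_filter_mem G i fun F => g i F * g i F, phi_apply, Finset.sum_filter,
    ← Finset.sum_coe_sort (edgeComplex G)]
  refine Finset.sum_congr rfl fun F _ => ?_
  split_ifs with h
  · rw [gammaMatrix_apply_of_mem _ h]
  · rw [gammaMatrix_apply_of_notMem _ h, zero_mul]

/-- A matrix with nonnegative off-diagonal entries that is diagonally dominant after a positive
scaling lies in the range of the edge parametrization. -/
theorem mem_range_phi_of_dominant {σ : Matrix V V ℝ} (hσ : σ.IsSymm)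
    (hadj : ∀ i j, i ≠ j → ¬ G.Adj i j → σ i j = 0) (hnonneg : ∀ i j, i ≠ j → 0 ≤ σ i j)
    {v : V → ℝ} (hv : ∀ i, 0 < v i) (hdom : ∀ i, ∑ j with G.Adj i j, σ i j * v j ≤ σ i i * v i) :
    σ ∈ Set.range (phi (edgeComplex G)) := by
  -- The ratios `v j / v i` cancel between the two ends of an edge, while the squares in row `i` sum
  -- to at most `σ i i` by dominance; the singleton column takes up the slack.
  let g : V → Finset V → ℝ := fun i F =>
    if F = {i} then √(σ i i - ∑ j with G.Adj i j, σ i j * (v j / v i))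
    else ∑ j ∈ F.erase i, √(σ i j * (v j / v i))
  have hpair : ∀ i j, i ≠ j → g i {i, j} = √(σ i j * (v j / v i)) := fun i j hij => by
    have h1 : ({i, j} : Finset V) ≠ {i} := fun h => by
      have : j ∈ ({i} : Finset V) := by rw [← h]; simp
      exact hij (Finset.mem_singleton.1 this).symm
    have h2 : ({i, j} : Finset V).erase i = {j} := by
      rw [Finset.erase_insert]; simpa using hij
    simp only [g, if_neg h1, h2, Finset.sum_singleton]
  refine ⟨fun F k => g k.1 F.1, Matrix.ext fun i j => ?_⟩
  by_cases hij : i = j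
  · subst hij
    rw [phi_apply_self_of_fun]
    have h1 : ∑ j with G.Adj i j, g i {i, j} * g i {i, j} =
        ∑ j with G.Adj i j, σ i j * (v j / v i) := by
      refine Finset.sum_congr rfl fun j hj => ?_
      have hne : i ≠ j := ((Finset.mem_filter.1 hj).2 : G.Adj i j).ne
      rw [hpair i j hne, Real.mul_self_sqrt]
      exact mul_nonneg (hnonneg i j hne) (div_pos (hv j) (hv i)).le
    rw [h1]
    simp only [g, if_true]
    rw [Real.mul_self_sqrt]
    · ring
    · rw [sub_nonneg]
      have : ∑ j with G.Adj i j, σ i j * (v j / v i) =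
          (∑ j with G.Adj i j, σ i j * v j) / v i := by
        rw [Finset.sum_div]
        exact Finset.sum_congr rfl fun j _ => by ring
      rw [this, div_le_iff₀ (hv i)]
      exact hdom i
  · by_cases h : G.Adj i j
    · rw [phi_apply_of_adj G _ h, gammaMatrix_apply_of_mem _ (by simp),
        gammaMatrix_apply_of_mem _ (by simp)]
      change g i {i, j} * g j {i, j} = _
      rw [hpair i j hij, Finset.pair_comm, hpair j i (Ne.symm hij), hσ.apply i j,
        ← Real.sqrt_mul (mul_nonneg (hnonneg i j hij) (div_pos (hv j) (hv i)).le)]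
      have hi := (hv i).ne'
      have hj := (hv j).ne'
      rw [show σ i j * (v j / v i) * (σ i j * (v i / v j)) = σ i j * σ i j by field_simp,
        Real.sqrt_mul_self (hnonneg i j hij)]
    · rw [phi_apply_of_not_adj G _ hij h, hadj i j hij h]

/-- For ε below 1 all preimages can be found in one compact box, whose continuous image is closed;
let ε tend to 0. -/
theorem mem_range_phi_of_forall_add {Δ : Finset (Finset V)} {σ : Matrix V V ℝ}
    (h : ∀ ε : ℝ, 0 < ε → σ + ε • (1 : Matrix V V ℝ) ∈ Set.range (phi Δ)) :
    σ ∈ Set.range (phi Δ) := by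
  set C : ℝ := 1 + ∑ i, |σ i i| with hC
  have hsum : ∀ i, |σ i i| ≤ ∑ i, |σ i i| := fun i =>
    Finset.single_le_sum (f := fun i => |σ i i|) (fun _ _ => abs_nonneg _) (Finset.mem_univ i)
  have hC1 : 1 ≤ C := le_add_of_nonneg_right (Finset.sum_nonneg fun _ _ => abs_nonneg _)
  let K : Set (Param Δ) := Set.pi Set.univ fun _ => Set.pi Set.univ fun _ => Set.Icc (-C) C
  have hK : IsCompact K := isCompact_univ_pi fun _ => isCompact_univ_pi fun _ => isCompact_Icc
  have hclosed : IsClosed (phi Δ '' K) := (hK.image (continuous_phi Δ)).isClosed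
  refine Set.image_subset_range (phi Δ) K ?_
  have hlim : Filter.Tendsto (fun ε : ℝ => σ + ε • (1 : Matrix V V ℝ)) (nhdsWithin 0 (Set.Ioi 0))
      (nhds σ) := by
    have : Continuous fun ε : ℝ => σ + ε • (1 : Matrix V V ℝ) := by fun_prop
    have h0 := this.tendsto 0
    simp only [zero_smul, add_zero] at h0
    exact h0.mono_left nhdsWithin_le_nhds
  refine hclosed.mem_of_tendsto hlim ?_
  filter_upwards [Ioo_mem_nhdsGT (zero_lt_one' ℝ)] with ε hε
  obtain ⟨γ, hγ⟩ := h ε hε.1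
  refine ⟨γ, ?_, hγ⟩
  have hb := abs_le_of_phi_le (γ := γ) (zero_le_one.trans hC1) fun i => by
    have h1 : phi Δ γ i i = σ i i + ε := by
      rw [hγ]; simp
    have h2 := hsum i
    have h3 := le_abs_self (σ i i)
    have h4 := hε.2
    nlinarith
  simp only [K, Set.mem_pi, Set.mem_univ, true_imp_iff, Set.mem_Icc]
  exact fun F i => abs_le.1 (hb F i)

end Parametrization

/-! ### Involutions along edges correspond to matchings. -/

section Involutions

open Equiv

variable {V : Type*} [Fintype V] [DecidableEq V]

/-- The set of two-element orbits of an involution, as a set of edges. -/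
def orbitPairs (τ : Perm V) : Finset (Sym2 V) := τ.support.image fun i => s(i, τ i)

theorem mk_mem_orbitPairs {τ : Perm V} (hτ : ∀ i, τ (τ i) = i) {i j : V} :
    s(i, j) ∈ orbitPairs τ ↔ i ≠ j ∧ τ i = j := by
  simp only [orbitPairs, Finset.mem_image, Perm.mem_support]
  constructor
  · rintro ⟨k, hk, h⟩
    rcases Sym2.eq_iff.1 h with ⟨rfl, rfl⟩ | ⟨rfl, rfl⟩
    · exact ⟨hk.symm, rfl⟩
    · exact ⟨hk, hτ _⟩
  · rintro ⟨hij, rfl⟩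
    exact ⟨i, hij.symm, rfl⟩

theorem orbitPairs_injOn : Set.InjOn (orbitPairs (V := V)) {τ | ∀ i, τ (τ i) = i} := by
  intro τ hτ ρ hρ h
  ext i
  by_cases hi : τ i = i
  · by_contra hne
    have h1 : s(i, ρ i) ∈ orbitPairs ρ :=
      (mk_mem_orbitPairs hρ).2 ⟨fun h => hne (hi.trans h), rfl⟩
    rw [← h, mk_mem_orbitPairs hτ] at h1
    exact hne h1.2
  · have h1 : s(i, τ i) ∈ orbitPairs τ := (mk_mem_orbitPairs hτ).2 ⟨Ne.symm hi, rfl⟩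
    rw [h, mk_mem_orbitPairs hρ] at h1
    exact h1.2.symm

theorem filter_support_eq_pair {τ : Perm V} (hτ : ∀ i, τ (τ i) = i) {i : V} (hi : τ i ≠ i) :
    τ.support.filter (fun k => s(k, τ k) = s(i, τ i)) = {i, τ i} := by
  ext k
  simp only [Finset.mem_filter, Perm.mem_support, Finset.mem_insert, Finset.mem_singleton]
  constructor
  · rintro ⟨-, h⟩
    rcases Sym2.eq_iff.1 h with h | h
    · exact Or.inl h.1
    · exact Or.inr h.1
  · rintro (rfl | rfl)
    · exact ⟨hi, rfl⟩
    · rw [hτ]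
      exact ⟨hi.symm, Sym2.eq_swap⟩

theorem card_support_eq_two_mul {τ : Perm V} (hτ : ∀ i, τ (τ i) = i) :
    τ.support.card = 2 * (orbitPairs τ).card := by
  rw [Finset.card_eq_sum_card_fiberwise (f := fun i => s(i, τ i)) (t := orbitPairs τ)
    fun i hi => Finset.mem_image_of_mem _ hi, mul_comm, ← smul_eq_mul, ← Finset.sum_const]
  refine Finset.sum_congr rfl fun e he => ?_
  obtain ⟨i, hi, rfl⟩ := Finset.mem_image.1 he
  rw [Perm.mem_support] at hi
  rw [filter_support_eq_pair hτ hi, Finset.card_pair hi.symm]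

theorem sign_eq_neg_one_pow {τ : Perm V} (hτ : ∀ i, τ (τ i) = i) :
    Perm.sign τ = (-1) ^ (orbitPairs τ).card := by
  have h2 : τ ^ 2 = 1 := Perm.ext fun i => by simp [sq, hτ]
  rw [Perm.sign_of_pow_two_eq_one h2, Perm.card_fixedPoints,
    Nat.sub_sub_self τ.sum_cycleType_le, Perm.sum_cycleType, card_support_eq_two_mul hτ,
    Nat.mul_div_cancel_left _ two_pos]

theorem prod_support_eq {τ : Perm V} (hτ : ∀ i, τ (τ i) = i) (σ : Matrix V V ℝ) :
    ∏ i ∈ τ.support, σ i (τ i) = ∏ e ∈ orbitPairs τ, edgeSq σ e := by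
  rw [← Finset.prod_fiberwise_of_maps_to (g := fun i => s(i, τ i)) (t := orbitPairs τ)
    fun i hi => Finset.mem_image_of_mem _ hi]
  refine Finset.prod_congr rfl fun e he => ?_
  obtain ⟨i, hi, rfl⟩ := Finset.mem_image.1 he
  rw [Perm.mem_support] at hi
  rw [filter_support_eq_pair hτ hi, Finset.prod_pair hi.symm, hτ]
  rfl

theorem uncovered_orbitPairs {τ : Perm V} (hτ : ∀ i, τ (τ i) = i) :
    uncovered (orbitPairs τ) = τ.supportᶜ := by
  ext i
  simp only [uncovered, Finset.mem_filter, Finset.mem_univ, true_and, Finset.mem_compl,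
    Perm.mem_support, not_not]
  constructor
  · intro h
    by_contra hi
    exact h _ ((mk_mem_orbitPairs hτ).2 ⟨Ne.symm hi, rfl⟩) (Sym2.mem_mk_left _ _)
  · rintro hi e he hie
    obtain ⟨j, rfl⟩ := hie
    obtain ⟨h1, h2⟩ := (mk_mem_orbitPairs hτ).1 he
    exact h1 (hi.symm.trans h2)

variable (G : SimpleGraph V) [DecidableRel G.Adj]

theorem orbitPairs_mem_matchings {τ : Perm V} (hτ : ∀ i, τ (τ i) = i)
    (hG : ∀ i, τ i ≠ i → G.Adj i (τ i)) : orbitPairs τ ∈ matchings G := by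
  simp only [matchings, Finset.mem_filter, Finset.mem_powerset]
  constructor
  · intro e he
    obtain ⟨i, hi, rfl⟩ := Finset.mem_image.1 he
    exact SimpleGraph.mem_edgeFinset.2 (hG i (Perm.mem_support.1 hi))
  · rintro e he f hf hef v ⟨⟨a, rfl⟩, ⟨b, rfl⟩⟩
    refine hef ?_
    rw [← ((mk_mem_orbitPairs hτ).1 he).2, ← ((mk_mem_orbitPairs hτ).1 hf).2]

theorem exists_involution_of_mem_matchings {M : Finset (Sym2 V)} (hM : M ∈ matchings G) :
    ∃ τ : Perm V, (∀ i, τ (τ i) = i) ∧ (∀ i, τ i ≠ i → G.Adj i (τ i)) ∧ orbitPairs τ = M := by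
  simp only [matchings, Finset.mem_filter, Finset.mem_powerset] at hM
  obtain ⟨hMG, hM⟩ := hM
  have hadj : ∀ i j, s(i, j) ∈ M → G.Adj i j := fun i j h => by
    simpa using hMG h
  have huniq : ∀ i j k, s(i, j) ∈ M → s(i, k) ∈ M → j = k := fun i j k hj hk => by
    by_contra hjk
    exact hM _ hj _ hk (fun h => hjk (Sym2.congr_right.1 h)) i
      ⟨Sym2.mem_mk_left _ _, Sym2.mem_mk_left _ _⟩
  classical
  -- Swap the ends of each matching edge and fix the uncovered vertices.
  let f : V → V := fun i => if h : ∃ j, s(i, j) ∈ M then h.choose else i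
  have hf : ∀ i j, s(i, j) ∈ M → f i = j := fun i j h => by
    have h' : ∃ j, s(i, j) ∈ M := ⟨j, h⟩
    simp only [f, dif_pos h']
    exact huniq i _ _ h'.choose_spec h
  have hf' : ∀ i, f i ≠ i → s(i, f i) ∈ M := fun i hi => by
    by_cases h : ∃ j, s(i, j) ∈ M
    · obtain ⟨j, hj⟩ := h
      rwa [hf i j hj]
    · exact absurd (dif_neg h) hi
  have hinv : Function.Involutive f := fun i => by
    by_cases hi : f i = i
    · rw [hi, hi]
    · exact hf _ _ (Sym2.eq_swap ▸ hf' i hi)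
  refine ⟨hinv.toPerm, hinv, fun i hi => hadj _ _ (hf' i hi), ?_⟩
  ext e
  induction e with | _ i j
  refine (mk_mem_orbitPairs (τ := hinv.toPerm) hinv).trans ?_
  constructor
  · rintro ⟨hij, rfl⟩
    exact hf' i hij.symm
  · intro h
    exact ⟨(hadj i j h).ne, hf i j h⟩

theorem sum_involutions_eq_matchingSum (σ : Matrix V V ℝ)
    [DecidablePred fun τ : Perm V => ∀ i, τ (τ i) = i]
    (hσ : ∀ i j, i ≠ j → ¬ G.Adj i j → σ i j = 0) :
    ∑ τ : Perm V with ∀ i, τ (τ i) = i, (Perm.sign τ : ℤ) * ∏ i, σ i (τ i) =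
      matchingSum G σ := by
  have hsub : ∑ τ : Perm V with (∀ i, τ (τ i) = i) ∧ ∀ i, τ i ≠ i → G.Adj i (τ i),
        (Perm.sign τ : ℤ) * ∏ i, σ i (τ i) =
      ∑ τ : Perm V with ∀ i, τ (τ i) = i, (Perm.sign τ : ℤ) * ∏ i, σ i (τ i) := by
    refine Finset.sum_subset (fun τ => by simp +contextual) fun τ h1 h2 => ?_
    simp only [Finset.mem_filter, Finset.mem_univ, true_and] at h1 h2
    obtain ⟨i, hi, hadj⟩ : ∃ i, τ i ≠ i ∧ ¬ G.Adj i (τ i) := by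
      by_contra! h
      exact h2 ⟨h1, h⟩
    have h0 : ∏ i, σ i (τ i) = 0 :=
      Finset.prod_eq_zero (Finset.mem_univ i) (hσ i (τ i) hi.symm hadj)
    rw [h0, mul_zero]
  rw [← hsub, matchingSum]
  refine Finset.sum_bij (fun τ _ => orbitPairs τ) ?_ ?_ ?_ ?_
  · intro τ hτ
    simp only [Finset.mem_filter, Finset.mem_univ, true_and] at hτ
    exact orbitPairs_mem_matchings G hτ.1 hτ.2
  · intro τ hτ ρ hρ h
    simp only [Finset.mem_filter, Finset.mem_univ, true_and] at hτ hρ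
    exact orbitPairs_injOn hτ.1 hρ.1 h
  · intro M hM
    obtain ⟨τ, h1, h2, h3⟩ := exists_involution_of_mem_matchings G hM
    exact ⟨τ, by simp only [Finset.mem_filter, Finset.mem_univ, true_and]; exact ⟨h1, h2⟩, h3⟩
  · intro τ hτ
    simp only [Finset.mem_filter, Finset.mem_univ, true_and] at hτ
    rw [sign_eq_neg_one_pow hτ.1, uncovered_orbitPairs hτ.1, ← prod_support_eq hτ.1,
      ← Finset.prod_mul_prod_compl τ.support, mul_assoc]
    congr 1
    · push_cast; rfl
    · congr 1
      refine Finset.prod_congr rfl fun i hi => ?_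
      rw [Perm.notMem_support.1 (Finset.mem_compl.1 hi)]

end Involutions

/-! ### Leibniz expansion of the determinant on a cycle. -/

section Cycle

open Equiv SimpleGraph

variable {n : ℕ}

theorem cycleGraph_adj_iff {i j : Fin (n + 3)} :
    (cycleGraph (n + 3)).Adj i j ↔ j = i + 1 ∨ i = j + 1 := by
  rw [cycleGraph_adj, sub_eq_iff_eq_add', sub_eq_iff_eq_add', or_comm]

open Fin.NatCast Fin.CommRing in
-- A forward step that is not reversed propagates: the next vertex cannot stay put, by injectivity,
-- nor step back, so it moves forward. Nor is this new step reversed, since injectivity would then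
-- give 2 = 0 modulo `n + 3`.
theorem eq_finRotate_of_adj {τ : Perm (Fin (n + 3))}
    (hτ : ∀ i, τ i ≠ i → (cycleGraph (n + 3)).Adj i (τ i)) {i : Fin (n + 3)}
    (h1 : τ i = i + 1) (h2 : τ (i + 1) ≠ i) : τ = finRotate (n + 3) := by
  have hne : ∀ k : Fin (n + 3), k + 1 ≠ k := fun k h => by simp at h
  have key : ∀ k : ℕ, τ (i + (k : Fin (n + 3))) = i + (k : Fin (n + 3)) + 1 ∧
      τ (i + (k : Fin (n + 3)) + 1) ≠ i + (k : Fin (n + 3)) := by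
    intro k
    induction k with
    | zero => simpa using ⟨h1, h2⟩
    | succ k ih =>
      obtain ⟨ih1, ih2⟩ := ih
      rw [Nat.cast_succ, ← add_assoc]
      set j := i + (k : Fin (n + 3))
      have hj : τ (j + 1) = j + 1 + 1 := by
        have h3 : τ (j + 1) ≠ j + 1 := fun h => hne j (τ.injective (h.trans ih1.symm))
        rcases cycleGraph_adj_iff.1 (hτ _ h3) with h | h
        · exact h
        · exact absurd (add_right_cancel h).symm ih2
      refine ⟨hj, fun h => ?_⟩
      have h4 : τ (j + 1 + 1) = τ j := h.trans ih1.symm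
      have h5 := τ.injective h4
      have h6 : (1 : Fin (n + 3)) + 1 = 0 := by
        rw [add_assoc] at h5
        exact add_eq_left.1 h5
      simp [Fin.ext_iff, Fin.val_add, Nat.mod_eq_of_lt] at h6
  ext1 j
  have := (key (j - i).val).1
  rw [Fin.cast_val_eq_self, add_sub_cancel] at this
  rw [this, finRotate_apply]

theorem involutive_or_eq_finRotate {τ : Perm (Fin (n + 3))}
    (hτ : ∀ i, τ i ≠ i → (cycleGraph (n + 3)).Adj i (τ i)) :
    (∀ i, τ (τ i) = i) ∨ τ = finRotate (n + 3) ∨ τ = (finRotate (n + 3))⁻¹ := by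
  by_contra! h
  obtain ⟨⟨i, hi⟩, h1, h2⟩ := h
  have hne : τ i ≠ i := fun h => hi (by rw [h, h])
  rcases cycleGraph_adj_iff.1 (hτ i hne) with h | h
  · exact h1 (eq_finRotate_of_adj hτ h (h ▸ hi))
  -- A backward step of `τ` from `i` is a forward step of the inverse from `τ i`.
  · refine h2 (inv_eq_iff_eq_inv.1 (eq_finRotate_of_adj (i := τ i) (fun k hk => ?_) ?_ ?_))
    · have h3 : τ (τ⁻¹ k) = k := τ.apply_symm_apply k
      have h4 := hτ (τ⁻¹ k) (by rw [h3]; exact hk.symm)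
      rw [h3] at h4
      exact h4.symm
    · exact (τ.symm_apply_apply i).trans h
    · rw [← h]
      intro h5
      rw [Perm.inv_eq_iff_eq] at h5
      exact hi h5.symm

theorem det_eq_matchingSum_add (σ : Matrix (Fin (n + 3)) (Fin (n + 3)) ℝ) (hσ : σ.IsSymm)
    (hadj : ∀ i j, i ≠ j → ¬ (cycleGraph (n + 3)).Adj i j → σ i j = 0) :
    σ.det = matchingSum (cycleGraph (n + 3)) σ + 2 * ((-1) ^ n * ∏ i, σ i (i + 1)) := by
  have hrot : ¬ ∀ i, finRotate (n + 3) (finRotate (n + 3) i) = i := fun h => by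
    have := h 0
    simp only [finRotate_apply] at this
    simp [Fin.ext_iff, Fin.val_add, Nat.mod_eq_of_lt] at this
  have hrot' : ¬ ∀ i, (finRotate (n + 3))⁻¹ ((finRotate (n + 3))⁻¹ i) = i := fun h => by
    refine hrot fun i => ?_
    have := h (finRotate (n + 3) (finRotate (n + 3) i))
    simpa using this.symm
  have hne : finRotate (n + 3) ≠ (finRotate (n + 3))⁻¹ := fun h => by
    refine hrot fun i => ?_
    nth_rewrite 1 [h]
    exact Equiv.symm_apply_apply _ _
  have hsgn : (Perm.sign (finRotate (n + 3)) : ℤ) = (-1) ^ n := by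
    rw [sign_finRotate]
    simp [pow_succ]
  rw [← Matrix.det_transpose, Matrix.det_apply',
    ← Finset.sum_filter_add_sum_filter_not _ fun τ : Perm (Fin (n + 3)) => ∀ i, τ (τ i) = i]
  simp only [Matrix.transpose_apply]
  rw [sum_involutions_eq_matchingSum _ σ hadj]
  congr 1
  have hsub : ({finRotate (n + 3), (finRotate (n + 3))⁻¹} : Finset (Perm (Fin (n + 3)))) ⊆
      Finset.univ.filter fun τ => ¬ ∀ i, τ (τ i) = i := by
    intro τ hτ
    rw [Finset.mem_insert, Finset.mem_singleton] at hτ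
    rw [Finset.mem_filter]
    rcases hτ with rfl | rfl
    · exact ⟨Finset.mem_univ _, hrot⟩
    · exact ⟨Finset.mem_univ _, hrot'⟩
  rw [← Finset.sum_subset hsub, Finset.sum_pair hne, Perm.sign_inv, hsgn]
  · have h1 : ∏ i, σ i (finRotate (n + 3) i) = ∏ i, σ i (i + 1) := by
      simp only [finRotate_apply]
    have h2 : ∏ i, σ i ((finRotate (n + 3))⁻¹ i) = ∏ i, σ i (i + 1) := by
      rw [← h1, ← Equiv.prod_comp (finRotate (n + 3))]
      refine Finset.prod_congr rfl fun i _ => ?_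
      rw [← hσ.apply]
      exact congrArg (σ · _) (Equiv.symm_apply_apply _ _)
    rw [h1, h2]
    push_cast
    ring
  · intro τ h1 h2
    simp only [Finset.mem_filter, Finset.mem_univ, true_and] at h1
    simp only [Finset.mem_insert, Finset.mem_singleton] at h2
    obtain ⟨i, hi, hi'⟩ : ∃ i, τ i ≠ i ∧ ¬ (cycleGraph (n + 3)).Adj i (τ i) := by
      by_contra! h
      rcases involutive_or_eq_finRotate h with h | h
      · exact h1 h
      · exact h2 h
    have h0 : ∏ i, σ i (τ i) = 0 :=
      Finset.prod_eq_zero (Finset.mem_univ i) (hadj i (τ i) hi.symm hi')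
    rw [h0, mul_zero]

end Cycle

/-! ### Comparison matrices and membership in the image for an arbitrary graph. -/

section Comparison

open Matrix

variable {V : Type*} [DecidableEq V]

/-- The comparison matrix: all off-diagonal entries are replaced by minus their absolute values. -/
def comparisonMatrix (σ : Matrix V V ℝ) : Matrix V V ℝ :=
  Matrix.of fun i j => if i = j then σ i i else -|σ i j|

theorem comparisonMatrix_self (σ : Matrix V V ℝ) (i : V) : comparisonMatrix σ i i = σ i i := by
  simp [comparisonMatrix]

theorem comparisonMatrix_of_ne (σ : Matrix V V ℝ) {i j : V} (h : i ≠ j) :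
    comparisonMatrix σ i j = -|σ i j| := by
  simp [comparisonMatrix, h]

theorem comparisonMatrix_isSymm {σ : Matrix V V ℝ} (hσ : σ.IsSymm) :
    (comparisonMatrix σ).IsSymm := by
  ext i j
  rw [transpose_apply]
  by_cases h : i = j
  · rw [h]
  · rw [comparisonMatrix_of_ne σ h, comparisonMatrix_of_ne σ (Ne.symm h), hσ.apply]

theorem posDef_add_smul_one {M : Matrix V V ℝ} (hM : M.PosSemidef) {ε : ℝ} (hε : 0 < ε) :
    (M + ε • (1 : Matrix V V ℝ)).PosDef :=
  PosDef.posSemidef_add hM (PosDef.one.smul hε)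

/-- If `M` has nonnegative determinant and agrees outside the first row and column with a positive
definite matrix, then it is positive semidefinite. -/
theorem posSemidef_of_det_nonneg {k : ℕ} {M S : Matrix (Fin (k + 1)) (Fin (k + 1)) ℝ}
    (hM : M.IsSymm) (hS : S.PosDef) (h : ∀ i j : Fin k, M i.succ j.succ = S i.succ j.succ)
    (hdet : 0 ≤ M.det) : M.PosSemidef := by
  refine PosSemidef.of_dotProduct_mulVec_nonneg
    (by rw [IsHermitian, conjTranspose_eq_transpose_of_trivial, hM.eq]) fun x => ?_
  rw [star_trivial]
  -- The first column of the adjugate is sent to a multiple of the first basis vector, and its first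
  -- entry is a principal minor shared with `S`. Subtracting a multiple of it from `x` leaves a
  -- vector `z` with zero first entry, on which the two quadratic forms agree.
  let y : Fin (k + 1) → ℝ := fun i => M.adjugate i 0
  have hMy : M *ᵥ y = M.det • Pi.single 0 1 := by
    have h1 := congrArg (· *ᵥ (Pi.single 0 1 : Fin (k + 1) → ℝ)) M.mul_adjugate
    simp only [← mulVec_mulVec, smul_mulVec, one_mulVec] at h1
    rw [← h1]
    congr 1
    ext i
    simp [y]
  have hy : 0 < y 0 := by
    have h1 : M.submatrix Fin.succ Fin.succ = S.submatrix Fin.succ Fin.succ :=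
      Matrix.ext fun i j => h i j
    have h2 := (hS.submatrix (Fin.succ_injective k)).det_pos
    simp only [y, adjugate_fin_succ_eq_det_submatrix]
    simpa [Fin.succAbove_zero, h1] using h2
  set t : ℝ := x 0 / y 0 with ht
  set z : Fin (k + 1) → ℝ := x - t • y with hz
  have hz0 : z 0 = 0 := by
    simp [hz, ht, hy.ne']
  have hx : x = t • y + z := by simp [hz]
  have hyz : y ⬝ᵥ M *ᵥ z = 0 := by
    rw [dotProduct_mulVec, ← mulVec_transpose, hM.eq, hMy, smul_dotProduct, single_dotProduct, hz0]
    simp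
  have hzz : z ⬝ᵥ M *ᵥ z = z ⬝ᵥ S *ᵥ z := by
    simp only [dotProduct, mulVec, Fin.sum_univ_succ, hz0, h, zero_mul, mul_zero, zero_add]
  have hSz := hS.posSemidef.dotProduct_mulVec_nonneg z
  rw [star_trivial] at hSz
  have key : x ⬝ᵥ M *ᵥ x = t * M.det * x 0 + z ⬝ᵥ M *ᵥ z := by
    conv_lhs => rw [hx, mulVec_add, mulVec_smul, hMy, ← hx, dotProduct_add]
    congr 1
    · simp; ring
    · conv_lhs => rw [hx, add_dotProduct, smul_dotProduct, hyz, smul_zero, zero_add]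
  rw [key, hzz]
  have h3 : t * M.det * x 0 = M.det * (x 0 * x 0) / y 0 := by rw [ht]; ring
  rw [h3]
  have := mul_self_nonneg (x 0)
  positivity

variable [Fintype V]

/-- A positive definite matrix with nonpositive off-diagonal entries sends some positive vector to
the all ones vector. -/
theorem exists_pos_mulVec_eq_one {M : Matrix V V ℝ} (hM : M.PosDef)
    (hoff : ∀ i j, i ≠ j → M i j ≤ 0) : ∃ v : V → ℝ, (∀ i, 0 < v i) ∧ ∀ i, (M *ᵥ v) i = 1 := by
  let v : V → ℝ := M⁻¹ *ᵥ 1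
  have hv : M *ᵥ v = 1 := by
    simp only [v, mulVec_mulVec]
    rw [mul_nonsing_inv _ ((isUnit_iff_isUnit_det _).1 hM.isUnit), one_mulVec]
  -- With `q` the negative part of `v`, the products `q i * (v i + q i)` vanish, so only nonpositive
  -- off-diagonal terms remain in `q ⬝ᵥ M *ᵥ (v + q)`. As `q ⬝ᵥ M *ᵥ v` is nonnegative, definiteness
  -- forces `q = 0`.
  let q : V → ℝ := fun i => max (-v i) 0
  have hq : ∀ i, 0 ≤ q i := fun i => le_max_right _ _
  have hvq : ∀ i, 0 ≤ v i + q i := fun i => by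
    have := le_max_left (-v i) 0
    simp only [q]; linarith
  have hcross : ∀ i, q i * (v i + q i) = 0 := fun i => by
    simp only [q]
    rcases le_total (-v i) 0 with h | h
    · rw [max_eq_right h, zero_mul]
    · rw [max_eq_left h]; ring
  have h1 : q ⬝ᵥ M *ᵥ (v + q) ≤ 0 := by
    simp only [dotProduct, mulVec, Finset.mul_sum]
    refine Finset.sum_nonpos fun i _ => Finset.sum_nonpos fun j _ => ?_
    rw [Pi.add_apply]
    by_cases hij : i = j
    · subst hij
      rw [mul_left_comm, hcross, mul_zero]
    · rw [mul_left_comm]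
      exact mul_nonpos_of_nonpos_of_nonneg (hoff i j hij) (mul_nonneg (hq i) (hvq j))
  have h2 : 0 ≤ q ⬝ᵥ M *ᵥ v := by
    rw [hv]
    exact Finset.sum_nonneg fun i _ => mul_nonneg (hq i) zero_le_one
  have hq0 : q = 0 := by
    by_contra hne
    have h3 := hM.dotProduct_mulVec_pos hne
    rw [star_trivial] at h3
    rw [mulVec_add, dotProduct_add] at h1
    linarith
  have hv0 : ∀ i, 0 ≤ v i := fun i => by
    have := hvq i
    rwa [hq0, Pi.zero_apply, add_zero] at this
  refine ⟨v, fun i => (hv0 i).lt_of_ne fun h0 => ?_, fun i => by rw [hv, Pi.one_apply]⟩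
  have h4 : (M *ᵥ v) i ≤ 0 := by
    simp only [mulVec, dotProduct]
    refine Finset.sum_nonpos fun j _ => ?_
    by_cases hij : i = j
    · rw [← hij, ← h0, mul_zero]
    · exact mul_nonpos_of_nonpos_of_nonneg (hoff i j hij) (hv0 j)
  rw [hv, Pi.one_apply] at h4
  linarith

/-- A matrix supported on a graph lies in the range of the edge parametrization exactly when its
comparison matrix is positive semidefinite. -/
theorem mem_range_phi_iff_posSemidef_comparisonMatrix [LinearOrder V] (G : SimpleGraph V)
    [DecidableRel G.Adj] {σ : Matrix V V ℝ} (hσ : σ.IsSymm)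
    (hadj : ∀ i j, i ≠ j → ¬ G.Adj i j → σ i j = 0) :
    σ ∈ Set.range (phi (edgeComplex G)) ↔ (comparisonMatrix σ).PosSemidef := by
  constructor
  · intro h
    obtain ⟨γ, hγ⟩ := mem_range_phi_of_abs_eq G (comparisonMatrix_isSymm hσ)
      (comparisonMatrix_self σ)
      (fun i j hij => by rw [comparisonMatrix_of_ne σ hij, abs_neg, abs_abs]) h
    exact hγ ▸ posSemidef_phi _ γ
  · intro h
    refine mem_range_phi_of_forall_add fun ε hε => ?_
    have hPD := posDef_add_smul_one h hε
    obtain ⟨v, hv, hMv⟩ := exists_pos_mulVec_eq_one hPD fun i j hij => by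
      simp [comparisonMatrix_of_ne σ hij, hij]
    let N : Matrix V V ℝ := Matrix.of fun i j => if i = j then σ i i + ε else |σ i j|
    have hNself : ∀ i, N i i = σ i i + ε := fun i => by simp [N]
    have hNne : ∀ i j, i ≠ j → N i j = |σ i j| := fun i j hij => by simp [N, hij]
    have hN : N ∈ Set.range (phi (edgeComplex G)) := by
      refine mem_range_phi_of_dominant G ?_ ?_ ?_ hv ?_
      · ext i j
        rw [transpose_apply]
        by_cases hij : i = j
        · rw [hij]
        · rw [hNne i j hij, hNne j i (Ne.symm hij), hσ.apply]
      · intro i j hij hG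
        rw [hNne i j hij, hadj i j hij hG, abs_zero]
      · intro i j hij
        rw [hNne i j hij]
        exact abs_nonneg _
      · intro i
        have h1 := hMv i
        rw [mulVec, dotProduct, ← Finset.add_sum_erase _ _ (Finset.mem_univ i)] at h1
        have h2 : ∑ j with G.Adj i j, N i j * v j = ∑ j ∈ Finset.univ.erase i, |σ i j| * v j := by
          refine (Finset.sum_congr rfl fun j hj => ?_).trans
            (Finset.sum_subset (fun j hj => ?_) fun j hj hj' => ?_)
          · rw [hNne i j ((Finset.mem_filter.1 hj).2 : G.Adj i j).ne]
          · rw [Finset.mem_erase]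
            exact ⟨((Finset.mem_filter.1 hj).2 : G.Adj i j).ne', Finset.mem_univ _⟩
          · rw [hadj i j (Finset.ne_of_mem_erase hj).symm fun h => hj' (by simpa using h),
              abs_zero, zero_mul]
        have h3 : ∑ j ∈ Finset.univ.erase i,
              (comparisonMatrix σ + ε • (1 : Matrix V V ℝ)) i j * v j =
            -∑ j ∈ Finset.univ.erase i, |σ i j| * v j := by
          rw [← Finset.sum_neg_distrib]
          refine Finset.sum_congr rfl fun j hj => ?_
          have hij : i ≠ j := (Finset.ne_of_mem_erase hj).symm
          simp [comparisonMatrix_of_ne σ hij, hij]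
        rw [h3] at h1
        simp only [Matrix.add_apply, Matrix.smul_apply, one_apply_eq, comparisonMatrix_self, smul_eq_mul,
          mul_one] at h1
        rw [h2, hNself]
        linarith
    refine mem_range_phi_of_abs_eq G ?_ (fun i => ?_) (fun i j hij => ?_) hN
    · simp [IsSymm, transpose_add, hσ.eq]
    · rw [hNself]; simp
    · rw [hNne i j hij]; simp [hij]

end Comparison

/-! ### Semidefiniteness of the comparison matrix of a cycle. -/

section CycleComparison

open Matrix SimpleGraph

theorem matchingSum_congr {V : Type*} [Fintype V] [DecidableEq V] (G : SimpleGraph V)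
    [DecidableRel G.Adj] {σ τ : Matrix V V ℝ} (h : ∀ i j, i ≠ j → σ i j * σ j i = τ i j * τ j i)
    (hdiag : ∀ i, σ i i = τ i i) : matchingSum G σ = matchingSum G τ := by
  refine Finset.sum_congr rfl fun M hM => ?_
  simp only [matchings, Finset.mem_filter, Finset.mem_powerset] at hM
  simp only [hdiag]
  congr 2
  refine Finset.prod_congr rfl fun e he => ?_
  have hG := hM.1 he
  induction e with | _ i j
  exact h i j (by simpa using hG : G.Adj i j).ne

variable {n : ℕ}

/-- The signs are chosen by walking along the path; only the closing edge is left uncontrolled. -/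
theorem exists_signs_of_ne_last (a : Fin (n + 1) → ℝ) :
    ∃ d : Fin (n + 1) → ℝ, (∀ i, d i * d i = 1) ∧
      ∀ i, i ≠ Fin.last n → d i * a i * d (i + 1) = -|a i| := by
  let b : ℕ → ℝ := fun k => if h : k < n + 1 then -unitSign (a ⟨k, h⟩) else 1
  have hb : ∀ k, b k * b k = 1 := fun k => by
    simp only [b]
    split_ifs
    · rw [neg_mul_neg, unitSign_mul_self]
    · rw [mul_one]
  have hd : ∀ k, (∏ l ∈ Finset.range k, b l) * (∏ l ∈ Finset.range k, b l) = 1 := fun k => by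
    simp only [← Finset.prod_mul_distrib, hb, Finset.prod_const_one]
  refine ⟨fun i => ∏ l ∈ Finset.range i, b l, fun i => hd i, fun i hi => ?_⟩
  have h1 : ((i + 1 : Fin (n + 1)) : ℕ) = i + 1 :=
    Fin.val_add_one_of_lt (Fin.lt_last_iff_ne_last.2 hi)
  have h2 : b i = -unitSign (a i) := dif_pos i.2
  beta_reduce
  rw [h1, Finset.prod_range_succ, h2, mul_right_comm, ← mul_assoc, hd, one_mul, neg_mul,
    unitSign_mul]

theorem exists_signs_of_ne (a : Fin (n + 1) → ℝ) (k : Fin (n + 1)) :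
    ∃ d : Fin (n + 1) → ℝ, (∀ i, d i * d i = 1) ∧
      ∀ i, i ≠ k → d i * a i * d (i + 1) = -|a i| := by
  obtain ⟨d, hd, h⟩ := exists_signs_of_ne_last fun i => a (i + (k + 1))
  refine ⟨fun i => d (i - (k + 1)), fun i => hd _, fun i hi => ?_⟩
  have h1 := h (i - (k + 1)) fun h => hi (by
    rw [sub_eq_iff_eq_add] at h
    rw [h, add_left_comm, Fin.last_add_one, add_zero])
  rw [sub_add_cancel] at h1
  rw [← h1, sub_add_eq_add_sub]

theorem eq_comparisonMatrix_apply {σ τ : Matrix (Fin (n + 3)) (Fin (n + 3)) ℝ} (hτ : τ.IsSymm)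
    (hσ : σ.IsSymm) (hadj : ∀ i j, i ≠ j → ¬ (cycleGraph (n + 3)).Adj i j → σ i j = 0)
    (hadj' : ∀ i j, i ≠ j → ¬ (cycleGraph (n + 3)).Adj i j → τ i j = 0)
    (hdiag : ∀ i, τ i i = σ i i) {i j : Fin (n + 3)}
    (h1 : j = i + 1 → τ i (i + 1) = -|σ i (i + 1)|)
    (h2 : i = j + 1 → τ j (j + 1) = -|σ j (j + 1)|) : τ i j = comparisonMatrix σ i j := by
  by_cases hij : i = j
  · rw [hij, comparisonMatrix_self, hdiag]
  · rw [comparisonMatrix_of_ne σ hij]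
    by_cases hG : (cycleGraph (n + 3)).Adj i j
    · rcases cycleGraph_adj_iff.1 hG with h | h
      · have := h1 h
        rwa [← h] at this
      · have := h2 h
        rw [← h] at this
        rw [← hτ.apply, ← hσ.apply, this]
    · rw [hadj i j hij hG, hadj' i j hij hG, abs_zero, neg_zero]

theorem det_comparisonMatrix_cycleGraph {σ : Matrix (Fin (n + 3)) (Fin (n + 3)) ℝ} (hσ : σ.IsSymm)
    (hadj : ∀ i j, i ≠ j → ¬ (cycleGraph (n + 3)).Adj i j → σ i j = 0) :
    (comparisonMatrix σ).det =
      matchingSum (cycleGraph (n + 3)) σ - 2 * ∏ i : Fin (n + 3), |σ i (i + 1)| := by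
  rw [det_eq_matchingSum_add _ (comparisonMatrix_isSymm hσ) fun i j hij hG => by
      rw [comparisonMatrix_of_ne σ hij, hadj i j hij hG, abs_zero, neg_zero],
    matchingSum_congr _ (τ := σ) (fun i j hij => ?_) (comparisonMatrix_self σ)]
  · have h : ∀ i : Fin (n + 3), comparisonMatrix σ i (i + 1) = -1 * |σ i (i + 1)| := fun i => by
      rw [comparisonMatrix_of_ne σ (by simp), neg_one_mul]
    simp only [h, Finset.prod_mul_distrib, Finset.prod_const, Finset.card_univ, Fintype.card_fin]
    rw [← mul_assoc ((-1) ^ n), ← pow_add, Odd.neg_one_pow ⟨n + 1, by ring⟩]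
    ring
  · rw [comparisonMatrix_of_ne σ hij, comparisonMatrix_of_ne σ (Ne.symm hij), neg_mul_neg,
      hσ.apply, abs_mul_abs_self]

theorem posSemidef_comparisonMatrix_cycleGraph {σ : Matrix (Fin (n + 3)) (Fin (n + 3)) ℝ}
    (hσ : σ.PosSemidef) (hsymm : σ.IsSymm)
    (hadj : ∀ i j, i ≠ j → ¬ (cycleGraph (n + 3)).Adj i j → σ i j = 0)
    (hle : 2 * ∏ i : Fin (n + 3), |σ i (i + 1)| ≤ matchingSum (cycleGraph (n + 3)) σ) :
    (comparisonMatrix σ).PosSemidef := by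
  let S : (Fin (n + 3) → ℝ) → Matrix (Fin (n + 3)) (Fin (n + 3)) ℝ := fun d =>
    diagonal d * σ * diagonal d
  have hS : ∀ d i j, S d i j = d i * σ i j * d j := fun d i j => by
    simp [S]
  have hSpsd : ∀ d, (S d).PosSemidef := fun d => by
    have := hσ.mul_mul_conjTranspose_same (diagonal d)
    rwa [diagonal_conjTranspose, star_trivial] at this
  have hSsymm : ∀ d, (S d).IsSymm := fun d => Matrix.ext fun i j => by
    rw [transpose_apply, hS, hS, hsymm.apply]; ring
  have hSadj : ∀ d i j, i ≠ j → ¬ (cycleGraph (n + 3)).Adj i j → S d i j = 0 :=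
    fun d i j hij hG => by rw [hS, hadj i j hij hG, mul_zero, zero_mul]
  have hSdiag : ∀ d, (∀ i, d i * d i = 1) → ∀ i, S d i i = σ i i := fun d hd i => by
    rw [hS, mul_right_comm, hd, one_mul]
  have hall : ∀ d : Fin (n + 3) → ℝ, (∀ i, d i * d i = 1) → (∀ i, d i * σ i (i + 1) * d (i + 1) = -|σ i (i + 1)|) →
      (comparisonMatrix σ).PosSemidef := fun d hd h => by
    have : S d = comparisonMatrix σ := Matrix.ext fun i j =>
      eq_comparisonMatrix_apply (hSsymm d) hsymm hadj (hSadj d) (hSdiag d hd)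
        (fun _ => by rw [hS]; exact h i) (fun _ => by rw [hS]; exact h j)
    exact this ▸ hSpsd d
  -- If some edge entry vanishes, its sign does not matter, and the signs can be arranged on all
  -- other edges.
  by_cases hzero : ∃ k : Fin (n + 3), σ k (k + 1) = 0
  · obtain ⟨k, hk⟩ := hzero
    obtain ⟨d, hd, h⟩ := exists_signs_of_ne (fun i => σ i (i + 1)) k
    refine hall d hd fun i => ?_
    by_cases hi : i = k
    · rw [hi, hk]; simp
    · exact h i hi
  push Not at hzero
  obtain ⟨d, hd, h⟩ := exists_signs_of_ne (fun i => σ i (i + 1)) (Fin.last (n + 2))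
  by_cases hlast : d (Fin.last (n + 2)) * σ (Fin.last (n + 2)) (Fin.last (n + 2) + 1) *
      d (Fin.last (n + 2) + 1) = -|σ (Fin.last (n + 2)) (Fin.last (n + 2) + 1)|
  · refine hall d hd fun i => ?_
    by_cases hi : i = Fin.last (n + 2)
    · rw [hi, hlast]
    · exact h i hi
  have hlast' : S d (Fin.last (n + 2)) (Fin.last (n + 2) + 1) =
      |σ (Fin.last (n + 2)) (Fin.last (n + 2) + 1)| := by
    have habs : ∀ i, |d i| = 1 := fun i => by
      have := hd i
      rw [← abs_mul_abs_self] at this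
      nlinarith [abs_nonneg (d i)]
    rw [hS]
    refine (eq_or_eq_neg_of_abs_eq ?_).resolve_right hlast
    rw [abs_mul, abs_mul, habs, habs, one_mul, mul_one]
  have hpos : 0 < ∏ i : Fin (n + 3), |σ i (i + 1)| :=
    Finset.prod_pos fun i _ => abs_pos.2 (hzero i)
  have hprod : ∏ i, S d i (i + 1) = (-1) ^ n * ∏ i : Fin (n + 3), |σ i (i + 1)| := by
    rw [Fin.prod_univ_castSucc, Fin.prod_univ_castSucc (fun i : Fin (n + 3) => |σ i (i + 1)|),
      hlast', ← mul_assoc]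
    congr 1
    have : ∀ i : Fin (n + 2), S d i.castSucc (i.castSucc + 1) =
        -1 * |σ i.castSucc (i.castSucc + 1)| := fun i => by
      rw [hS, neg_one_mul]
      exact h _ (Fin.castSucc_lt_last i).ne
    simp only [this, Finset.prod_mul_distrib, Finset.prod_const, Finset.card_univ,
      Fintype.card_fin]
    rw [pow_add]; norm_num
  -- The one wrong sign flips the rotation term, so the determinant is the matching sum plus twice
  -- the positive product.
  have hdet : 0 < (S d).det := by
    rw [det_eq_matchingSum_add _ (hSsymm d) (hSadj d), hprod, ← mul_assoc ((-1) ^ n), ← mul_pow,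
      matchingSum_congr _ (τ := σ) (fun i j _ => ?_) (hSdiag d hd)]
    · norm_num
      linarith
    · rw [hS, hS]
      linear_combination (σ i j * σ j i) * (d i * d i * hd j + hd i)
  refine posSemidef_of_det_nonneg (comparisonMatrix_isSymm hsymm)
    ((hSpsd d).posDef_iff_det_ne_zero.2 hdet.ne') (fun i j => ?_) ?_
  -- The exceptional edge joins the last vertex to vertex 0, so it is invisible once row and column
  -- 0 are removed.
  · refine (eq_comparisonMatrix_apply (hSsymm d) hsymm hadj (hSadj d) (hSdiag d hd)
      (fun hij => ?_) fun hij => ?_).symm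
    all_goals
      rw [hS]
      refine h _ fun hl => ?_
      rw [hl, Fin.last_add_one] at hij
      exact Fin.succ_ne_zero _ hij
  · rw [det_comparisonMatrix_cycleGraph hsymm hadj]
    linarith

end CycleComparison

end EdgeParam

theorem mainTheorem1 (m : ℕ) [NeZero m] (hm : 3 ≤ m) (σ : Matrix (Fin m) (Fin m) ℝ)
    (hσ : σ ∈ EdgeParam.graphicalCone (SimpleGraph.cycleGraph m)) :
    σ ∈ Set.range (EdgeParam.phi (EdgeParam.edgeComplex (SimpleGraph.cycleGraph m))) ↔
      2 * ∏ i : Fin m, |σ i (i + 1)| ≤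
        EdgeParam.matchingSum (SimpleGraph.cycleGraph m) σ := by
  obtain ⟨n, rfl⟩ := Nat.exists_eq_add_of_le' hm
  obtain ⟨hpsd, hadj⟩ := hσ
  have hsymm : σ.IsSymm := by
    rw [Matrix.IsSymm, ← Matrix.conjTranspose_eq_transpose_of_trivial]
    exact hpsd.isHermitian
  rw [EdgeParam.mem_range_phi_iff_posSemidef_comparisonMatrix _ hsymm hadj]
  constructor
  · intro h
    have := h.det_nonneg
    rwa [EdgeParam.det_comparisonMatrix_cycleGraph hsymm hadj, sub_nonneg] at this
  · exact EdgeParam.posSemidef_comparisonMatrix_cycleGraph hpsd hsymm hadj
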